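/- **Proposition 6.3.** *Setting.* Assume $2^{\omega_1}=\omega_2$ and fix a bijection $\pi:\omega_2\to H(\omega_2)$. Let $\mathcal Y\subseteq P_{\omega_1}(\omega_2)$ be a stationary set of countable subsets of $\omega_2$ which is thin (for every $\beta<\omega_2$ the set $\{a\cap\beta : a\in\mathcal Y\}$ has size at most $\omega_1$) and closed under initial segments ($a\cap\beta\in\mathcal Y$ for all $a\in\mathcal Y$, $\beta<\omega_2$). Let $\mathcal A=(H(\omega_2),\in,\pi,\mathcal Y)$, and for $a\subseteq H(\omega_2)$ let $Sk(a)$ be the closure of $a$ under the definable Skolem functions of $\mathcal A$ given by the well-ordering induced by $\pi$. Let - $C$ be the set of $\beta<\omega_2$ with $Sk(\beta)\cap\omega_2=\beta$; - $\Lambda$ be the set of $\beta<\omega_2$ of cofinality $\omega_1$ which are limit points of $C$; - $\mathcal X$ be the set of $M\in\mathcal Y$ such that $Sk(M)\cap\omega_2=M$ and $\sup(C\cap\gamma)\in M$ for all $\gamma\in M$; - $\Gamma\subseteq\Lambda$ be a fixed stationary subset of $\omega_2$. For $M\in\mathcal X$ let $\Gamma_M$ be the set of $\beta\in\Gamma$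 with $\beta=\min(\Gamma\setminus\sup(M\cap\beta))$, and for $M,N\in\mathcal X$ let $\beta_{M,N}=\max(\Gamma_M\cap\Gamma_N)$. A set $A\subseteq\mathcal X$ is *adequate* if for all $M,N\in A$, either $M\cap\beta_{M,N}=N\cap\beta_{M,N}$, or $M\cap\beta_{M,N}\in Sk(N)$, or $N\cap\beta_{M,N}\in Sk(M)$. Let $\mathbb P$ be the forcing poset of all triples $(a,x,A)$ such that: 1. $a$ is a finite subset of $\omega_2\cap\mathrm{cof}(\omega)$; 2. $x$ is a finite set of triples $\langle\alpha,\gamma,\beta\rangle$ with $\alpha\in\Gamma$ and $\gamma<\beta<\alpha$; 3. $A$ is a finite adequate set; 4. if $\langle\alpha,\gamma,\beta\rangle$ and $\langle\alpha,\gamma',\beta'\rangle$ are distinct triples in $x$, then $[\gamma,\beta)\cap[\gamma',\beta')=\emptyset$; 5. if $\xi\in a$, $M\in A$, $\sup(M\cap\xi)=\xi$ and $M\setminus\xi\neq\emptyset$, then $\xi\in M$; 6. if $M\in A$, $\alpha\in M$ and $\langle\alpha,\gamma,\beta\rangle\in x$, then: if $M\cap[\gamma,\beta]\neq\emptyset$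 then $\gamma,\beta\in M$, and if $M\cap[\gamma,\beta]=\emptyset$ then $\sup(M\cap\alpha)<\gamma$; ordered by $(b,y,B)\le(a,x,A)$ iff $a\subseteq b$, $x\subseteq y$ and $A\subseteq B$. *Claim.* $\mathbb P$ is $\omega_2$-c.c.: every set of pairwise incompatible conditions of $\mathbb P$ has size less than $\omega_2$. -/

import Mathlib

open scoped Cardinal Ordinal

namespace AdequateForcing

/-- The ordinal `ω₂`. -/
noncomputable abbrev omegaTwo : Ordinal.{0} := ω_ 2

/-- `H(ω₂)`: the collection of all sets that are hereditarily of cardinality less than `ω₂`. -/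
def HOmegaTwo : Type 1 :=
  {x : ZFSet.{0} // x.Hereditarily (fun y => y.card < ℵ_ 2)}

/-- Enumerations of `H(ω₂)` in order type `ω₂`: bijections from `ω₂` onto `H(ω₂)`. -/
abbrev Enumeration : Type 1 := Set.Iio omegaTwo ≃ HOmegaTwo

/-- The element `x` of `H(ω₂)` is the (von Neumann) ordinal `α`. -/
def IsOrd (x : HOmegaTwo) (α : Ordinal.{0}) : Prop := x.1 = α.toZFSet

/-- The element `x` of `H(ω₂)` is the set of ordinals `a`. -/
def IsSetOfOrds (x : HOmegaTwo) (a : Set Ordinal.{0}) : Prop :=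
  (x.1 : Set ZFSet.{0}) = Ordinal.toZFSet '' a

/-! ### Stationary and thin sets -/

/-- `P_{ω₁}(ω₂)`: the countable subsets of `ω₂`. -/
def countableSubsets : Set (Set Ordinal.{0}) :=
  {a | a.Countable ∧ a ⊆ Set.Iio omegaTwo}

/-- Closed unbounded subsets of `P_{ω₁}(ω₂)`. (Closure under unions of `ω`-chains gives closure
under unions of increasing chains of every nonzero countable length.) -/
def IsClubCountable (D : Set (Set Ordinal.{0})) : Prop :=
  D ⊆ countableSubsets ∧
  (∀ a ∈ countableSubsets, ∃ b ∈ D, a ⊆ b) ∧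
  ∀ s : ℕ → Set Ordinal.{0}, Monotone s → (∀ n, s n ∈ D) → (⋃ n, s n) ∈ D

/-- Stationary subsets of `P_{ω₁}(ω₂)`. -/
def IsStationaryCountable (Y : Set (Set Ordinal.{0})) : Prop :=
  Y ⊆ countableSubsets ∧ ∀ D, IsClubCountable D → (Y ∩ D).Nonempty

/-- `Y` is thin: for each `β < ω₂`, the set `{a ∩ β : a ∈ Y}` has size at most `ω₁`. -/
def IsThin (Y : Set (Set Ordinal.{0})) : Prop :=
  ∀ β < omegaTwo, #((fun a : Set Ordinal.{0} => a ∩ Set.Iio β) '' Y) ≤ ℵ₁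

/-- `Y` is closed under initial segments. -/
def ClosedUnderInitialSegments (Y : Set (Set Ordinal.{0})) : Prop :=
  ∀ a ∈ Y, ∀ β < omegaTwo, a ∩ Set.Iio β ∈ Y

/-- `β` is a limit point of the set of ordinals `D`. -/
def IsLimitPoint (D : Set Ordinal.{0}) (β : Ordinal.{0}) : Prop :=
  β ≠ 0 ∧ ∀ γ < β, ∃ δ ∈ D, γ < δ ∧ δ < β

/-- Closed unbounded subsets of `ω₂`. -/
def IsClub (D : Set Ordinal.{0}) : Prop :=
  D ⊆ Set.Iio omegaTwo ∧ (∀ β < omegaTwo, IsLimitPoint D β → β ∈ D) ∧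
  ∀ α < omegaTwo, ∃ β ∈ D, α ≤ β

/-- Stationary subsets of `ω₂`. -/
def IsStationary (S : Set Ordinal.{0}) : Prop :=
  S ⊆ Set.Iio omegaTwo ∧ ∀ D, IsClub D → (S ∩ D).Nonempty

/-! ### The structure `𝒜 = (H(ω₂), ∈, π, 𝒴)` and its Skolem hulls -/

/-- Relation symbols for the structure `𝒜`. -/
inductive Rel : ℕ → Type
  | mem : Rel 2
  | enum : Rel 2
  | thin : Rel 1

/-- The language of the structure `𝒜`. -/
def lang : FirstOrder.Language.{0, 0} := ⟨fun _ => Empty, Rel⟩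

/-- The structure `𝒜 = (H(ω₂), ∈, π, 𝒴)`. The function `π`, whose domain is `ω₂ ⊆ H(ω₂)`, is
represented by its graph. -/
@[reducible]
def structA (π : Enumeration) (Y : Set (Set Ordinal.{0})) : lang.Structure HOmegaTwo where
  funMap := fun f _ => f.elim
  RelMap := fun {_} R => match R with
    | Rel.mem => fun v => (v 0).1 ∈ (v 1).1
    | Rel.enum => fun v => ∃ α : Set.Iio omegaTwo, IsOrd (v 0) α.1 ∧ v 1 = π α
    | Rel.thin => fun v => ∃ a ∈ Y, IsSetOfOrds (v 0) a

/-- `𝒜 ⊨ φ(v₀, …, vₙ₋₁, y)`. -/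
def Sat (π : Enumeration) (Y : Set (Set Ordinal.{0})) {n : ℕ}
    (φ : lang.BoundedFormula Empty (n + 1)) (v : Fin n → HOmegaTwo) (y : HOmegaTwo) : Prop :=
  letI := structA π Y
  φ.Realize default (Fin.snoc v y : Fin (n + 1) → HOmegaTwo)

/-- `y` is the value at `v` of the definable Skolem function for `φ` that is induced by the
well-ordering `π`: the `π`-least `y` with `𝒜 ⊨ φ(v, y)`. -/
def IsSkolemValue (π : Enumeration) (Y : Set (Set Ordinal.{0})) {n : ℕ}
    (φ : lang.BoundedFormula Empty (n + 1)) (v : Fin n → HOmegaTwo) (y : HOmegaTwo) : Prop :=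
  Sat π Y φ v y ∧ ∀ z, Sat π Y φ v z → π.symm y ≤ π.symm z

/-- `Sk(s)`: the closure of `s ⊆ H(ω₂)` under the definable Skolem functions induced by `π`.
(Since hulls under definable Skolem functions are exactly the definable closures, any other choice
of a full set of definable Skolem functions yields the same hull.) -/
inductive Sk (π : Enumeration) (Y : Set (Set Ordinal.{0})) (s : Set HOmegaTwo) : HOmegaTwo → Prop
  | base (x : HOmegaTwo) (hx : x ∈ s) : Sk π Y s x
  | skolem (n : ℕ) (φ : lang.BoundedFormula Empty (n + 1)) (v : Fin n → HOmegaTwo)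
      (hv : ∀ i, Sk π Y s (v i)) (y : HOmegaTwo) (hy : IsSkolemValue π Y φ v y) : Sk π Y s y

/-- `Sk(a)` for a set of ordinals `a ⊆ ω₂`. -/
def SkOrd (π : Enumeration) (Y : Set (Set Ordinal.{0})) (a : Set Ordinal.{0}) : Set HOmegaTwo :=
  {x | Sk π Y {z | ∃ α ∈ a, IsOrd z α} x}

/-- `Sk(a) ∩ ω₂`. -/
def SkTrace (π : Enumeration) (Y : Set (Set Ordinal.{0})) (a : Set Ordinal.{0}) :
    Set Ordinal.{0} :=
  {α | α < omegaTwo ∧ ∃ x ∈ SkOrd π Y a, IsOrd x α}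

/-- `b ∈ Sk(a)`, for sets of ordinals `a` and `b`. -/
def MemSk (π : Enumeration) (Y : Set (Set Ordinal.{0})) (b a : Set Ordinal.{0}) : Prop :=
  ∃ x ∈ SkOrd π Y a, IsSetOfOrds x b

/-! ### The sets `C`, `Λ` and `𝒳` -/

/-- `C` is the set of `β < ω₂` with `Sk(β) ∩ ω₂ = β`. -/
def clubC (π : Enumeration) (Y : Set (Set Ordinal.{0})) : Set Ordinal.{0} :=
  {β | β < omegaTwo ∧ SkTrace π Y (Set.Iio β) = Set.Iio β}

/-- `Λ` is the set of limit points of `C` in `ω₂` of cofinality `ω₁`. -/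
def setLambda (π : Enumeration) (Y : Set (Set Ordinal.{0})) : Set Ordinal.{0} :=
  {β | β < omegaTwo ∧ β.cof = ℵ₁ ∧ IsLimitPoint (clubC π Y) β}

/-- `𝒳` is the set of `M ∈ 𝒴` with `Sk(M) ∩ ω₂ = M` and `sup(C ∩ γ) ∈ M` for all `γ ∈ M`. -/
def models (π : Enumeration) (Y : Set (Set Ordinal.{0})) : Set (Set Ordinal.{0}) :=
  {M | M ∈ Y ∧ SkTrace π Y M = M ∧ ∀ γ ∈ M, sSup (clubC π Y ∩ Set.Iio γ) ∈ M}

/-! ### Comparison points and adequate sets -/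

/-- `Γ_M`: the set of `β ∈ Γ` with `β = min (Γ \ sup(M ∩ β))`. -/
def gammaOf (Γ M : Set Ordinal.{0}) : Set Ordinal.{0} :=
  {β | β ∈ Γ ∧ IsLeast {δ | δ ∈ Γ ∧ sSup (M ∩ Set.Iio β) ≤ δ} β}

/-- The comparison point `β_{M,N}`: the largest element of `Γ_M ∩ Γ_N` (which exists for all
`M, N ∈ 𝒳` when `Γ ⊆ Λ` is stationary). -/
noncomputable def comparisonPoint (Γ M N : Set Ordinal.{0}) : Ordinal.{0} :=
  sSup (gammaOf Γ M ∩ gammaOf Γ N)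

/-- `A ⊆ 𝒳` is adequate: for all `M, N ∈ A`, with `β = β_{M,N}`, either `M ∩ β = N ∩ β`, or
`M ∩ β ∈ Sk(N)`, or `N ∩ β ∈ Sk(M)`. -/
def IsAdequate (π : Enumeration) (Y : Set (Set Ordinal.{0})) (Γ : Set Ordinal.{0})
    (A : Set (Set Ordinal.{0})) : Prop :=
  A ⊆ models π Y ∧ ∀ M ∈ A, ∀ N ∈ A,
    M ∩ Set.Iio (comparisonPoint Γ M N) = N ∩ Set.Iio (comparisonPoint Γ M N) ∨
    MemSk π Y (M ∩ Set.Iio (comparisonPoint Γ M N)) N ∨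
    MemSk π Y (N ∩ Set.Iio (comparisonPoint Γ M N)) M

/-! ### The forcing poset -/

/-- Conditions of the forcing poset: triples `(a, x, A)`. A triple `(α, γ, β)` of `x` is written
here in this order of the components. -/
@[ext]
structure Condition (π : Enumeration) (Y : Set (Set Ordinal.{0})) (Γ : Set Ordinal.{0}) where
  a : Finset Ordinal.{0}
  x : Finset (Ordinal.{0} × Ordinal.{0} × Ordinal.{0})
  A : Finset (Set Ordinal.{0})
  a_cof : ∀ ξ ∈ a, ξ < omegaTwo ∧ ξ.cof = ℵ₀
  x_lt : ∀ α γ β, (α, γ, β) ∈ x → α ∈ Γ ∧ γ < β ∧ β < α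
  adequate : IsAdequate π Y Γ (A : Set (Set Ordinal.{0}))
  x_disjoint : ∀ α γ β γ' β', (α, γ, β) ∈ x → (α, γ', β') ∈ x →
    (α, γ, β) ≠ (α, γ', β') → Set.Ico γ β ∩ Set.Ico γ' β' = ∅
  a_closed : ∀ ξ ∈ a, ∀ M ∈ A, sSup (M ∩ Set.Iio ξ) = ξ → (M \ Set.Iio ξ).Nonempty → ξ ∈ M
  x_closed : ∀ M ∈ A, ∀ α ∈ M, ∀ γ β, (α, γ, β) ∈ x →
    ((M ∩ Set.Icc γ β).Nonempty → γ ∈ M ∧ β ∈ M) ∧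
    (M ∩ Set.Icc γ β = ∅ → sSup (M ∩ Set.Iio α) < γ)

/-- `q ≤ p` (that is, `q` is stronger than `p`) if every component of `q` includes the
corresponding component of `p`. -/
instance (π : Enumeration) (Y : Set (Set Ordinal.{0})) (Γ : Set Ordinal.{0}) :
    PartialOrder (Condition π Y Γ) where
  le q p := p.a ⊆ q.a ∧ p.x ⊆ q.x ∧ p.A ⊆ q.A
  le_refl p := ⟨subset_rfl, subset_rfl, subset_rfl⟩
  le_trans p q r h k := ⟨k.1.trans h.1, k.2.1.trans h.2.1, k.2.2.trans h.2.2⟩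
  le_antisymm p q h k := Condition.ext (k.1.antisymm h.1) (k.2.1.antisymm h.2.1)
    (k.2.2.antisymm h.2.2)

/-- Two elements of a forcing poset are compatible if they have a common extension. -/
def Compatible {P : Type*} [Preorder P] (p q : P) : Prop := ∃ r, r ≤ p ∧ r ≤ q

/-- A forcing poset is `ω₂`-c.c. if every set of pairwise incompatible elements has size less
than `ω₂`. -/
def OmegaTwoCC (P : Type*) [Preorder P] : Prop :=
  ∀ S : Set P, (∀ p ∈ S, ∀ q ∈ S, p ≠ q → ¬ Compatible p q) → #S < ℵ_ 2

end AdequateForcing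

namespace AdequateForcing

open Function

variable {π : Enumeration} {Y : Set (Set Ordinal.{0})}

/-! ### Elements of `H(ω₂)` -/

/-! Given `ω₂` many conditions `p β`, consider the trace of `p β` below `β`. For `β ∈ Γ` the
cofinality is `ω₁` and the support is countable, so the trace is bounded by some `δ < β`; thinness
leaves at most `ω₁` traces per `δ`. Pressing down (`IsStationary.exists_pair`) gives `β₁ < β₂` in
`Γ` with equal traces, both closed under a function bounding supports and the `π`-indices of the
sets `a ∩ ξ`, `a ∈ Y`.

The componentwise union of the two conditions is then a condition (`compatible_of_trace_eq`). The
hard clause is adequacy for `M` from the first and `N` from the second. Some `N'` in the first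
satisfies `N' ∩ β₁ = N ∩ β₂`. The comparison point of `M, N` is at most `β₁` and at most that of `M,
N'`, so comparability with `N'` restricts to it and transfers to `N` (`Comparable.of_inter_Iio_eq`).
Restriction requires hulls to be closed under initial segments of their countable sets of ordinals
(`MemSk.inter_Iio`); transfer requires that a model's hull is determined by the indices in the model
(`mem_skOrd_iff`). -/

theorem card_le_of_countable {x : ZFSet.{0}} (hx : (x : Set ZFSet.{0}).Countable) :
    x.card ≤ ℵ₁ := by
  have h : #x ≤ ℵ₀ := Cardinal.mk_le_aleph0_iff.2 hx.to_subtype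
  rw [ZFSet.cardinalMk_coe_sort, Cardinal.lift_le_aleph0] at h
  exact h.trans (Cardinal.aleph0_le_aleph 1)

theorem hereditarily_of_countable {x : ZFSet.{0}} (hc : (x : Set ZFSet.{0}).Countable)
    (hx : ∀ y ∈ x, y.Hereditarily (fun y => y.card < ℵ_ 2)) :
    x.Hereditarily (fun y => y.card < ℵ_ 2) :=
  ZFSet.hereditarily_iff.2
    ⟨(card_le_of_countable hc).trans_lt (Cardinal.aleph_lt_aleph.2 (by norm_num)), hx⟩

theorem hereditarily_toZFSet {α : Ordinal.{0}} (hα : α < omegaTwo) :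
    α.toZFSet.Hereditarily (fun y => y.card < ℵ_ 2) := by
  induction α using WellFoundedLT.induction with
  | ind α ih =>
    rw [ZFSet.hereditarily_iff]
    refine ⟨?_, fun y hy => ?_⟩
    · rw [Ordinal.card_toZFSet, ← Cardinal.lt_ord, Cardinal.ord_aleph]
      exact hα
    · obtain ⟨b, hb, rfl⟩ := Ordinal.mem_toZFSet_iff.1 hy
      exact ih b hb (hb.trans hα)

theorem lt_omegaTwo_of_isOrd {x : HOmegaTwo} {α : Ordinal.{0}} (h : IsOrd x α) :
    α < omegaTwo := by
  have := x.2.self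
  rw [h, Ordinal.card_toZFSet, ← Cardinal.lt_ord, Cardinal.ord_aleph] at this
  exact this

/-- The ordinal `α < ω₂` as an element of `H(ω₂)`. -/
noncomputable def ordElem (α : Ordinal.{0}) (hα : α < omegaTwo) : HOmegaTwo :=
  ⟨α.toZFSet, hereditarily_toZFSet hα⟩

theorem isOrd_ordElem {α : Ordinal.{0}} (hα : α < omegaTwo) : IsOrd (ordElem α hα) α := rfl

theorem IsOrd.eq_ordElem {x : HOmegaTwo} {α : Ordinal.{0}} (h : IsOrd x α) :
    x = ordElem α (lt_omegaTwo_of_isOrd h) := Subtype.ext h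

theorem IsOrd.unique {x : HOmegaTwo} {α β : Ordinal.{0}} (h : IsOrd x α) (h' : IsOrd x β) :
    α = β := Ordinal.toZFSet_injective (h.symm.trans h')

theorem omega0_lt_omegaTwo : ω < omegaTwo := by
  simpa using Ordinal.omega_lt_omega.2 (show (0 : Ordinal) < 2 by norm_num)

/-- The set `ω` as an element of `H(ω₂)`. -/
noncomputable def omegaElem : HOmegaTwo := ordElem ω omega0_lt_omegaTwo

theorem mem_omegaElem {y : ZFSet.{0}} :
    y ∈ omegaElem.1 ↔ ∃ n : ℕ, y = (n : Ordinal.{0}).toZFSet := by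
  change y ∈ Ordinal.toZFSet ω ↔ _
  rw [Ordinal.mem_toZFSet_iff]
  constructor
  · rintro ⟨a, ha, rfl⟩
    obtain ⟨n, rfl⟩ := Ordinal.lt_omega0.1 ha
    exact ⟨n, rfl⟩
  · rintro ⟨n, rfl⟩
    exact ⟨n, Ordinal.natCast_lt_omega0 n, rfl⟩

/-! ### First-order definability over `𝒜` -/

/-- The predicate `P` on assignments is defined over `𝒜` by a formula. -/
def DefinableIn (π : Enumeration) (Y : Set (Set Ordinal.{0})) (P : (ℕ → HOmegaTwo) → Prop) :
    Prop :=
  letI := structA π Y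
  ∃ φ : lang.Formula ℕ, ∀ v, φ.Realize v ↔ P v

namespace DefinableIn

variable {P Q : (ℕ → HOmegaTwo) → Prop}

theorem mem (i j : ℕ) : DefinableIn π Y (fun v => (v i).1 ∈ (v j).1) := by
  let _ := structA π Y
  refine ⟨FirstOrder.Language.Relations.formula₂ (L := lang) (show lang.Relations 2 from Rel.mem)
    (FirstOrder.Language.Term.var i) (FirstOrder.Language.Term.var j), fun v => ?_⟩
  rw [FirstOrder.Language.Formula.realize_rel₂]
  rfl

theorem enum (i j : ℕ) :
    DefinableIn π Y (fun v => ∃ α : Set.Iio omegaTwo, IsOrd (v i) α.1 ∧ v j = π α) := by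
  let _ := structA π Y
  refine ⟨FirstOrder.Language.Relations.formula₂ (L := lang) (show lang.Relations 2 from Rel.enum)
    (FirstOrder.Language.Term.var i) (FirstOrder.Language.Term.var j), fun v => ?_⟩
  rw [FirstOrder.Language.Formula.realize_rel₂]
  rfl

theorem eq (i j : ℕ) : DefinableIn π Y (fun v => v i = v j) := by
  let _ := structA π Y
  refine ⟨FirstOrder.Language.Term.equal (L := lang)
    (FirstOrder.Language.Term.var i) (FirstOrder.Language.Term.var j), fun v => ?_⟩
  rw [FirstOrder.Language.Formula.realize_equal]
  rfl

theorem not (hP : DefinableIn π Y P) : DefinableIn π Y (fun v => ¬ P v) := by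
  let _ := structA π Y
  obtain ⟨φ, hφ⟩ := hP
  refine ⟨φ.not, fun v => ?_⟩
  rw [FirstOrder.Language.Formula.realize_not, hφ]

theorem imp (hP : DefinableIn π Y P) (hQ : DefinableIn π Y Q) :
    DefinableIn π Y (fun v => P v → Q v) := by
  let _ := structA π Y
  obtain ⟨φ, hφ⟩ := hP
  obtain ⟨ψ, hψ⟩ := hQ
  refine ⟨φ.imp ψ, fun v => ?_⟩
  rw [FirstOrder.Language.Formula.realize_imp, hφ, hψ]

theorem and (hP : DefinableIn π Y P) (hQ : DefinableIn π Y Q) :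
    DefinableIn π Y (fun v => P v ∧ Q v) := by
  simpa using (hP.imp hQ.not).not

theorem or (hP : DefinableIn π Y P) (hQ : DefinableIn π Y Q) :
    DefinableIn π Y (fun v => P v ∨ Q v) := by
  simpa [or_iff_not_imp_left] using hP.not.imp hQ

theorem iff (hP : DefinableIn π Y P) (hQ : DefinableIn π Y Q) :
    DefinableIn π Y (fun v => (P v ↔ Q v)) := by
  simpa [iff_iff_implies_and_implies] using (hP.imp hQ).and (hQ.imp hP)

theorem all (k : ℕ) (hP : DefinableIn π Y P) :
    DefinableIn π Y (fun v => ∀ a, P (update v k a)) := by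
  let _ := structA π Y
  obtain ⟨φ, hφ⟩ := hP
  -- Variable `k` becomes the bound variable; all others stay free.
  let g : ℕ → ℕ ⊕ Fin 1 := fun i => if i = k then Sum.inr 0 else Sum.inl i
  refine ⟨(FirstOrder.Language.BoundedFormula.relabel (k := 0) g φ).all, fun v => ?_⟩
  rw [FirstOrder.Language.Formula.Realize, FirstOrder.Language.BoundedFormula.realize_all]
  refine forall_congr' fun a => ?_
  rw [FirstOrder.Language.BoundedFormula.realize_relabel, ← hφ,
    FirstOrder.Language.Formula.Realize]
  refine iff_of_eq (congrArg₂ _ ?_ (Subsingleton.elim _ _))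
  funext i
  by_cases h : i = k
  · subst h
    simp [g, Fin.snoc]
  · simp [g, h]

theorem ex (k : ℕ) (hP : DefinableIn π Y P) :
    DefinableIn π Y (fun v => ∃ a, P (update v k a)) := by
  simpa using (hP.not.all k).not

end DefinableIn

/-! ### Skolem hulls are elementary -/

/-- The assignment `(p, q, y, y, …)`. -/
def assign (p q y : HOmegaTwo) : ℕ → HOmegaTwo
  | 0 => p
  | 1 => q
  | _ => y

@[simp] theorem assign_zero (p q y : HOmegaTwo) : assign p q y 0 = p := rfl
@[simp] theorem assign_one (p q y : HOmegaTwo) : assign p q y 1 = q := rfl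
@[simp] theorem assign_two (p q y : HOmegaTwo) : assign p q y 2 = y := rfl

theorem exists_isSkolemValue {n : ℕ} (φ : lang.BoundedFormula Empty (n + 1))
    (v : Fin n → HOmegaTwo) (h : ∃ y, Sat π Y φ v y) : ∃ y, IsSkolemValue π Y φ v y := by
  obtain ⟨y, hy, hmin⟩ := WellFounded.has_min (InvImage.wf π.symm wellFounded_lt)
    {y | Sat π Y φ v y} h
  exact ⟨y, hy, fun z hz => not_lt.1 (hmin z hz)⟩

section Hull

variable {s : Set HOmegaTwo}

/-- The Tarski–Vaught property with two parameters: the `π`-least witness is a Skolem value. -/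
theorem Sk.exists_of_definableIn {P : (ℕ → HOmegaTwo) → Prop} (hP : DefinableIn π Y P)
    {p q : HOmegaTwo} (hp : Sk π Y s p) (hq : Sk π Y s q) (h : ∃ y, P (assign p q y)) :
    ∃ y, Sk π Y s y ∧ P (assign p q y) := by
  let _ := structA π Y
  obtain ⟨φ, hφ⟩ := hP
  let g : ℕ → Empty ⊕ Fin 3 := fun i => Sum.inr (match i with | 0 => 0 | 1 => 1 | _ => 2)
  let ψ : lang.BoundedFormula Empty (2 + 1) :=
    FirstOrder.Language.BoundedFormula.relabel (k := 0) g φ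
  have hψ : ∀ y, Sat π Y ψ ![p, q] y ↔ P (assign p q y) := by
    intro y
    rw [Sat, FirstOrder.Language.BoundedFormula.realize_relabel, ← hφ,
      FirstOrder.Language.Formula.Realize]
    refine iff_of_eq (congrArg₂ _ ?_ (Subsingleton.elim _ _))
    funext i
    match i with
    | 0 => rfl
    | 1 => rfl
    | _ + 2 => rfl
  obtain ⟨y, hy⟩ := exists_isSkolemValue (π := π) (Y := Y) ψ ![p, q]
    (by simpa only [hψ] using h)
  refine ⟨y, Sk.skolem 2 ψ ![p, q] ?_ y hy, (hψ y).1 hy.1⟩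
  intro i
  fin_cases i
  · exact hp
  · exact hq

theorem Sk.of_definableIn {P : (ℕ → HOmegaTwo) → Prop} (hP : DefinableIn π Y P)
    {p q y : HOmegaTwo} (hp : Sk π Y s p) (hq : Sk π Y s q) (hy : P (assign p q y))
    (huniq : ∀ z, P (assign p q z) → z = y) : Sk π Y s y := by
  obtain ⟨z, hz, hPz⟩ := Sk.exists_of_definableIn hP hp hq ⟨y, hy⟩
  exact huniq z hPz ▸ hz

/-- The Skolem function of `⊤` takes no arguments, so even the hull of `∅` is nonempty. This
supplies dummy parameters for parameter-free definitions. -/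
theorem Sk.exists_mem : ∃ x, Sk π Y s x := by
  let _ := structA π Y
  obtain ⟨y, hy⟩ := exists_isSkolemValue (π := π) (Y := Y) (n := 0) ⊤ ![]
    ⟨ordElem ω omega0_lt_omegaTwo, by simp [Sat]⟩
  exact ⟨y, Sk.skolem 0 ⊤ ![] (fun i => i.elim0) y hy⟩

theorem Sk.enum {x : HOmegaTwo} {α : Set.Iio omegaTwo} (hx : Sk π Y s x) (h : IsOrd x α.1) :
    Sk π Y s (π α) := by
  refine Sk.of_definableIn (DefinableIn.enum 0 2) hx hx ⟨α, h, rfl⟩ ?_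
  rintro z ⟨β, hβ, hz⟩
  rw [assign_two] at hz
  rw [hz, Subtype.ext (hβ.unique h)]

theorem Sk.index {x y : HOmegaTwo} (hx : Sk π Y s x) (h : IsOrd y (π.symm x).1) :
    Sk π Y s y := by
  refine Sk.of_definableIn (DefinableIn.enum 2 0) hx hx ⟨π.symm x, h, by simp⟩ ?_
  rintro z ⟨β, hβ, hz⟩
  rw [assign_zero] at hz
  rw [assign_two] at hβ
  subst hz
  rw [Equiv.symm_apply_apply] at h
  rw [h.eq_ordElem, hβ.eq_ordElem]

/-! ### Natural numbers and `ω` in every hull -/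

theorem isEmpty_definableIn (i : ℕ) (k : ℕ) (h : i ≠ k) :
    DefinableIn π Y (fun v => ∀ w : HOmegaTwo, w.1 ∉ (v i).1) := by
  simpa [h] using ((DefinableIn.mem k i).not).all (π := π) (Y := Y) k

/-- `y` is the successor `z ∪ {z}` of `z`. -/
def IsSuccOf (y z : HOmegaTwo) : Prop := ∀ w : HOmegaTwo, w.1 ∈ y.1 ↔ w.1 ∈ z.1 ∨ w = z

theorem isSuccOf_definableIn (i j k : ℕ) (hi : i ≠ k) (hj : j ≠ k) :
    DefinableIn π Y (fun v => IsSuccOf (v i) (v j)) := by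
  simpa [hi, hj, IsSuccOf] using ((DefinableIn.mem k i).iff ((DefinableIn.mem k j).or
    (DefinableIn.eq k j))).all (π := π) (Y := Y) k

/-- Testing elements of `H(ω₂)` suffices because `H(ω₂)` is transitive. -/
theorem HOmegaTwo.ext {x y : HOmegaTwo} (h : ∀ w : HOmegaTwo, w.1 ∈ x.1 ↔ w.1 ∈ y.1) :
    x = y := by
  refine Subtype.ext (ZFSet.ext fun z => ⟨fun hz => ?_, fun hz => ?_⟩)
  · exact (h ⟨z, x.2.mem hz⟩).1 hz
  · exact (h ⟨z, y.2.mem hz⟩).2 hz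

theorem natCast_lt_omegaTwo (n : ℕ) : (n : Ordinal.{0}) < omegaTwo :=
  (Ordinal.natCast_lt_omega0 n).trans omega0_lt_omegaTwo

theorem isSuccOf_natCast (n : ℕ) :
    IsSuccOf (ordElem ((n + 1 : ℕ) : Ordinal.{0}) (natCast_lt_omegaTwo _))
      (ordElem (n : Ordinal.{0}) (natCast_lt_omegaTwo _)) := by
  intro w
  change w.1 ∈ Ordinal.toZFSet _ ↔ w.1 ∈ Ordinal.toZFSet _ ∨ _
  rw [Nat.cast_succ, Ordinal.toZFSet_add_one, ZFSet.mem_insert_iff, or_comm]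
  exact or_congr Iff.rfl ⟨fun h => Subtype.ext h, fun h => congrArg Subtype.val h⟩

theorem Sk.natCast (n : ℕ) : Sk π Y s (ordElem (n : Ordinal.{0}) (natCast_lt_omegaTwo n)) := by
  induction n with
  | zero =>
    obtain ⟨x, hx⟩ := Sk.exists_mem (π := π) (Y := Y) (s := s)
    have h0 : ∀ w : HOmegaTwo,
        w.1 ∉ (ordElem ((0 : ℕ) : Ordinal.{0}) (natCast_lt_omegaTwo 0)).1 := by
      intro w
      simp [ordElem]
    refine Sk.of_definableIn (isEmpty_definableIn 2 3 (by decide)) hx hx h0 fun z hz => ?_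
    exact HOmegaTwo.ext fun w => iff_of_false (hz w) (h0 w)
  | succ n ih =>
    refine Sk.of_definableIn (isSuccOf_definableIn 2 0 3 (by decide) (by decide)) ih ih
      (isSuccOf_natCast n) fun z hz => ?_
    exact HOmegaTwo.ext fun w => (hz w).trans (isSuccOf_natCast n w).symm

/-- `x` is an inductive set. -/
def IsInductive (x : HOmegaTwo) : Prop :=
  (∃ z : HOmegaTwo, z.1 ∈ x.1 ∧ ∀ w : HOmegaTwo, w.1 ∉ z.1) ∧
    ∀ z : HOmegaTwo, z.1 ∈ x.1 → ∀ y : HOmegaTwo, IsSuccOf y z → y.1 ∈ x.1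

theorem isInductive_definableIn (i : ℕ) (hi : i < 4) :
    DefinableIn π Y (fun v => IsInductive (v i)) := by
  have h4 : i ≠ 4 := by omega
  have h5 : i ≠ 5 := by omega
  have h1 := ((DefinableIn.mem 4 i).and (isEmpty_definableIn 4 5 (by decide))).ex
    (π := π) (Y := Y) 4
  have h2 := ((DefinableIn.mem 4 i).imp (((isSuccOf_definableIn 5 4 6 (by decide)
    (by decide)).imp (DefinableIn.mem 5 i)).all 5)).all (π := π) (Y := Y) 4
  simpa [h4, h5, IsInductive] using h1.and h2

theorem isInductive_omegaElem : IsInductive omegaElem := by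
  refine ⟨⟨ordElem 0 (by simpa using natCast_lt_omegaTwo 0), mem_omegaElem.2 ⟨0, by simp [ordElem]⟩,
    by simp [ordElem]⟩, ?_⟩
  intro z hz y hy
  obtain ⟨n, hn⟩ := mem_omegaElem.1 hz
  have hz' : z = ordElem n (natCast_lt_omegaTwo n) := Subtype.ext hn
  subst hz'
  have : y = ordElem ((n + 1 : ℕ) : Ordinal.{0}) (natCast_lt_omegaTwo _) :=
    HOmegaTwo.ext fun w => (hy w).trans (isSuccOf_natCast n w).symm
  rw [this]
  exact mem_omegaElem.2 ⟨n + 1, rfl⟩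

theorem IsInductive.natCast_mem {x : HOmegaTwo} (hx : IsInductive x) (n : ℕ) :
    (ordElem (n : Ordinal.{0}) (natCast_lt_omegaTwo n)).1 ∈ x.1 := by
  induction n with
  | zero =>
    obtain ⟨⟨z, hz, hz0⟩, -⟩ := hx
    have : z = ordElem ((0 : ℕ) : Ordinal.{0}) (natCast_lt_omegaTwo 0) :=
      HOmegaTwo.ext fun w => iff_of_false (hz0 w) (by simp [ordElem])
    exact this ▸ hz
  | succ n ih => exact hx.2 _ ih _ (isSuccOf_natCast n)

/-- `ω` is definable as the least inductive set. -/
theorem Sk.omegaElem : Sk π Y s omegaElem := by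
  have hD : DefinableIn π Y (fun v => IsInductive (v 2) ∧
      ∀ y : HOmegaTwo, IsInductive y → ∀ z : HOmegaTwo, z.1 ∈ (v 2).1 → z.1 ∈ y.1) := by
    have h := ((isInductive_definableIn 3 (by decide)).imp (((DefinableIn.mem 4 2).imp
      (DefinableIn.mem 4 3)).all 4)).all (π := π) (Y := Y) 3
    simpa using (isInductive_definableIn 2 (by decide)).and h
  have hmin : ∀ y : HOmegaTwo, IsInductive y → ∀ z : HOmegaTwo,
      z.1 ∈ AdequateForcing.omegaElem.1 → z.1 ∈ y.1 := by
    intro y hy z hz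
    obtain ⟨n, hn⟩ := mem_omegaElem.1 hz
    rw [hn]
    exact hy.natCast_mem n
  obtain ⟨x, hx⟩ := Sk.exists_mem (π := π) (Y := Y) (s := s)
  refine Sk.of_definableIn hD hx hx ⟨isInductive_omegaElem, hmin⟩ ?_
  rintro z ⟨hz, hz'⟩
  exact HOmegaTwo.ext fun w => ⟨hz' _ isInductive_omegaElem w, hmin z hz w⟩

/-! ### Countable elements of a hull are subsets of it -/

/-- `y` is the partner of `n` in the family `p` of unordered pairs. -/
def IsPartner (p n y : HOmegaTwo) : Prop :=
  y ≠ n ∧ ∃ t : HOmegaTwo, t.1 ∈ p.1 ∧ n.1 ∈ t.1 ∧ y.1 ∈ t.1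

theorem isPartner_definableIn (i j k l : ℕ) (hi : i ≠ l) (hj : j ≠ l) (hk : k ≠ l) :
    DefinableIn π Y (fun v => IsPartner (v i) (v j) (v k)) := by
  have h := ((DefinableIn.mem l i).and ((DefinableIn.mem j l).and (DefinableIn.mem k l))).ex
    (π := π) (Y := Y) l
  simpa [hi, hj, hk, IsPartner] using (DefinableIn.eq k j).not.and h

/-- The partners of elements of `w` in the family `p` cover `x \ w`. -/
def CoversWith (x w p : HOmegaTwo) : Prop :=
  ∀ y : HOmegaTwo, y.1 ∈ x.1 → y.1 ∈ w.1 ∨ ∃ n : HOmegaTwo, n.1 ∈ w.1 ∧ IsPartner p n y ∧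
    ∀ z : HOmegaTwo, IsPartner p n z → z = y

theorem coversWith_definableIn :
    DefinableIn π Y (fun v => CoversWith (v 0) (v 1) (v 2)) := by
  have h1 := ((isPartner_definableIn 2 4 5 6 (by decide) (by decide) (by decide)).imp
    (DefinableIn.eq 5 3)).all (π := π) (Y := Y) 5
  have h2 := ((DefinableIn.mem 4 1).and ((isPartner_definableIn 2 4 3 6 (by decide) (by decide)
    (by decide)).and h1)).ex 4
  have h3 := ((DefinableIn.mem 3 0).imp ((DefinableIn.mem 3 1).or h2)).all 3
  simpa [CoversWith] using h3

/-- An injection `f : x → ω` is coded by the pairs `{f y, y}` with `y ∈ x \ ω`. Leaving out `y ∈ ω`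
tells the two members of a pair apart, so unordered pairs suffice. -/
theorem exists_coversWith {x : HOmegaTwo} (hx : (x.1 : Set ZFSet.{0}).Countable) :
    ∃ p, CoversWith x omegaElem p := by
  classical
  obtain ⟨f, hf⟩ := Set.countable_iff_exists_injOn.1 hx
  let e : {y : ZFSet.{0} // y ∈ x.1 ∧ y ∉ omegaElem.1} → ZFSet.{0} :=
    fun y => {((f y.1 : ℕ) : Ordinal.{0}).toZFSet, y.1}
  have : Countable {y : ZFSet.{0} // y ∈ x.1 ∧ y ∉ omegaElem.1} :=
    (hx.mono (fun y hy => hy.1) : Set.Countable {y : ZFSet.{0} | y ∈ x.1 ∧ y ∉ omegaElem.1})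
  have hmem : ∀ t, t ∈ ZFSet.range e ↔ ∃ y, (y ∈ x.1 ∧ y ∉ omegaElem.1) ∧
      t = {((f y : ℕ) : Ordinal.{0}).toZFSet, y} := by
    intro t
    rw [ZFSet.mem_range]
    constructor
    · rintro ⟨y, rfl⟩
      exact ⟨y.1, y.2, rfl⟩
    · rintro ⟨y, hy, rfl⟩
      exact ⟨⟨y, hy⟩, rfl⟩
  have hpair : ∀ y ∈ x.1, ZFSet.Hereditarily (fun y => y.card < ℵ_ 2)
      ({((f y : ℕ) : Ordinal.{0}).toZFSet, y} : ZFSet.{0}) := by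
    intro y hy
    refine hereditarily_of_countable (Set.Finite.countable ?_) ?_
    · refine Set.Finite.subset (Set.toFinite {((f y : ℕ) : Ordinal.{0}).toZFSet, y}) ?_
      intro z hz
      simpa using hz
    · intro z hz
      rcases ZFSet.mem_pair.1 hz with rfl | rfl
      · exact hereditarily_toZFSet (natCast_lt_omegaTwo _)
      · exact x.2.mem hy
  have hH : (ZFSet.range e).Hereditarily (fun y => y.card < ℵ_ 2) := by
    refine hereditarily_of_countable ?_ fun t ht => ?_
    · rw [ZFSet.coe_range]
      exact Set.countable_range e
    · obtain ⟨y, hy, rfl⟩ := (hmem t).1 ht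
      exact hpair y hy.1
  refine ⟨⟨_, hH⟩, fun y hy => or_iff_not_imp_left.2 fun hyw => ?_⟩
  refine ⟨ordElem _ (natCast_lt_omegaTwo (f y.1)), mem_omegaElem.2 ⟨_, rfl⟩, ⟨?_, ?_⟩, ?_⟩
  · intro h
    exact hyw (mem_omegaElem.2 ⟨_, congrArg Subtype.val h⟩)
  · exact ⟨⟨_, hpair y.1 hy⟩, (hmem _).2 ⟨y.1, ⟨hy, hyw⟩, rfl⟩, ZFSet.mem_pair.2 (Or.inl rfl),
      ZFSet.mem_pair.2 (Or.inr rfl)⟩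
  · rintro z ⟨hzn, t, ht, hnt, hzt⟩
    obtain ⟨u, ⟨hux, huw⟩, htu⟩ := (hmem _).1 ht
    rw [htu] at hnt hzt
    have hfu : f y.1 = f u := by
      rcases ZFSet.mem_pair.1 hnt with h | h
      · exact_mod_cast Ordinal.toZFSet_injective h
      · exact absurd (mem_omegaElem.2 ⟨_, h.symm⟩) huw
    have hyu : y.1 = u := hf hy hux hfu
    rcases ZFSet.mem_pair.1 hzt with h | h
    · exact absurd (Subtype.ext (h.trans (by rw [← hfu]; rfl))) hzn
    · exact Subtype.ext (h.trans hyu.symm)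

/-- By elementarity some covering family `p` lies in the hull. Each `y ∈ x` outside `ω` is then
definable from `p` and a natural number. -/
theorem Sk.mem_of_countable {x y : HOmegaTwo} (hx : Sk π Y s x)
    (hc : (x.1 : Set ZFSet.{0}).Countable) (hy : y.1 ∈ x.1) : Sk π Y s y := by
  have hω : ∀ n : HOmegaTwo, n.1 ∈ AdequateForcing.omegaElem.1 → Sk π Y s n := by
    intro n hn
    obtain ⟨k, hk⟩ := mem_omegaElem.1 hn
    rw [show n = ordElem _ (natCast_lt_omegaTwo k) from Subtype.ext hk]
    exact Sk.natCast k
  obtain ⟨p, hp, hcov⟩ := Sk.exists_of_definableIn coversWith_definableIn hx Sk.omegaElem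
    (exists_coversWith hc)
  rcases hcov y hy with h | ⟨n, hn, hyn, huniq⟩
  · exact hω y h
  · exact Sk.of_definableIn (isPartner_definableIn 0 1 2 3 (by decide) (by decide) (by decide))
      hp (hω n hn) hyn huniq

theorem Sk.inter {x y z : HOmegaTwo} (hx : Sk π Y s x) (hy : Sk π Y s y)
    (hz : ∀ w : HOmegaTwo, w.1 ∈ z.1 ↔ w.1 ∈ x.1 ∧ w.1 ∈ y.1) : Sk π Y s z := by
  have h : DefinableIn π Y (fun v => ∀ w : HOmegaTwo,
      w.1 ∈ (v 2).1 ↔ w.1 ∈ (v 0).1 ∧ w.1 ∈ (v 1).1) := by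
    simpa using ((DefinableIn.mem 3 2).iff ((DefinableIn.mem 3 0).and (DefinableIn.mem 3 1))).all
      (π := π) (Y := Y) 3
  refine Sk.of_definableIn h hx hy hz fun u hu => ?_
  exact HOmegaTwo.ext fun w => (hu w).trans (hz w).symm

end Hull

/-! ### Sets of ordinals in hulls -/

theorem exists_isSetOfOrds {b : Set Ordinal.{0}} (hb : b ∈ countableSubsets) :
    ∃ x : HOmegaTwo, IsSetOfOrds x b := by
  have : Countable b := hb.1
  have hr : ((ZFSet.range fun α : b => α.1.toZFSet : ZFSet.{0}) : Set ZFSet.{0}) =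
      Ordinal.toZFSet '' b := by
    rw [ZFSet.coe_range]
    ext; simp
  refine ⟨⟨ZFSet.range fun α : b => α.1.toZFSet, hereditarily_of_countable ?_ ?_⟩, hr⟩
  · rw [hr]
    exact hb.1.image _
  · intro y hy
    obtain ⟨α, rfl⟩ := ZFSet.mem_range.1 hy
    exact hereditarily_toZFSet (hb.2 α.2)

theorem IsSetOfOrds.mem_iff {x : HOmegaTwo} {b : Set Ordinal.{0}} (h : IsSetOfOrds x b)
    {y : ZFSet.{0}} : y ∈ x.1 ↔ ∃ α ∈ b, Ordinal.toZFSet α = y := by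
  rw [← SetLike.mem_coe, h]
  rfl

theorem IsSetOfOrds.unique {x y : HOmegaTwo} {b : Set Ordinal.{0}} (hx : IsSetOfOrds x b)
    (hy : IsSetOfOrds y b) : x = y :=
  HOmegaTwo.ext fun _ => hx.mem_iff.trans hy.mem_iff.symm

/-- The cut `ζ` need not lie in the hull. The least `η ∈ b` with `ζ ≤ η` does, since `b` is
countable, and it cuts `b` at the same place; if there is no such `η`, nothing is cut off. -/
theorem MemSk.inter_Iio {b N : Set Ordinal.{0}} (hb : b.Countable) (h : MemSk π Y b N)
    (ζ : Ordinal.{0}) : MemSk π Y (b ∩ Set.Iio ζ) N := by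
  obtain ⟨x, hx, hxb⟩ := h
  by_cases hζ : ∃ η ∈ b, ζ ≤ η
  · obtain ⟨η, ⟨hηb, hζη⟩, hmin⟩ := WellFounded.has_min (wellFounded_lt (α := Ordinal.{0}))
      {η | η ∈ b ∧ ζ ≤ η} hζ
    have hηx : η.toZFSet ∈ x.1 := hxb.mem_iff.2 ⟨η, hηb, rfl⟩
    have hη : η < omegaTwo := lt_omegaTwo_of_isOrd (x := ⟨_, x.2.mem hηx⟩) rfl
    have hbx : b ∩ Set.Iio ζ ∈ countableSubsets := by
      refine ⟨hb.mono Set.inter_subset_left, fun α hα => ?_⟩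
      exact (hα.2.trans_le hζη).trans hη
    obtain ⟨z, hz⟩ := exists_isSetOfOrds hbx
    refine ⟨z, ?_, hz⟩
    have hxc : (x.1 : Set ZFSet.{0}).Countable := by
      rw [hxb]
      exact hb.image _
    refine Sk.inter hx (Sk.mem_of_countable (y := ordElem η hη) hx hxc hηx) fun w => ?_
    rw [hz.mem_iff, hxb.mem_iff]
    constructor
    · rintro ⟨α, ⟨hα, hαζ⟩, hw⟩
      exact ⟨⟨α, hα, hw⟩, Ordinal.mem_toZFSet_iff.2 ⟨α, lt_of_lt_of_le hαζ hζη, hw⟩⟩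
    · rintro ⟨⟨α, hα, hw⟩, hwη⟩
      refine ⟨α, ⟨hα, ?_⟩, hw⟩
      rw [← hw] at hwη
      have hαη : α < η := Ordinal.toZFSet_mem_toZFSet_iff.1 hwη
      by_contra hc
      exact hmin α ⟨hα, not_lt.1 hc⟩ hαη
  · have : b ∩ Set.Iio ζ = b :=
      Set.inter_eq_left.2 fun α hα => not_le.1 fun hc => hζ ⟨α, hα, hc⟩
    rw [this]
    exact ⟨x, hx, hxb⟩

/-- Since `π` belongs to the structure, an element and its index are definable from each other. -/
theorem mem_skOrd_iff {N : Set Ordinal.{0}} (hN : SkTrace π Y N = N) {x : HOmegaTwo} :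
    x ∈ SkOrd π Y N ↔ (π.symm x).1 ∈ N := by
  constructor
  · intro hx
    rw [← hN]
    exact ⟨(π.symm x).2, _, Sk.index hx (isOrd_ordElem (π.symm x).2), isOrd_ordElem _⟩
  · intro hx
    have := Sk.enum (π := π) (Y := Y) (α := π.symm x)
      (Sk.base (s := {z | ∃ α ∈ N, IsOrd z α}) (ordElem _ (π.symm x).2) ⟨_, hx, rfl⟩) rfl
    rwa [Equiv.apply_symm_apply] at this

/-- Membership of `b` in the hulls of two models that agree below a bound for the index of `b`. -/
theorem MemSk.of_inter_Iio_eq {b N N' : Set Ordinal.{0}} {β : Ordinal.{0}}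
    (hN : SkTrace π Y N = N) (hN' : SkTrace π Y N' = N')
    (hNN' : N ∩ Set.Iio β = N' ∩ Set.Iio β)
    (hβ : ∀ x, IsSetOfOrds x b → (π.symm x).1 < β) (h : MemSk π Y b N') : MemSk π Y b N := by
  obtain ⟨x, hx, hxb⟩ := h
  refine ⟨x, (mem_skOrd_iff hN).2 ?_, hxb⟩
  have : (π.symm x).1 ∈ N' ∩ Set.Iio β := ⟨(mem_skOrd_iff hN').1 hx, hβ x hxb⟩
  rw [← hNN'] at this
  exact this.1

/-! ### Suprema and closure points below `ω₂` -/

theorem cof_omegaTwo : omegaTwo.cof = ℵ_ 2 := by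
  have := Cardinal.cof_omega_add_one 1
  rwa [one_add_one_eq_two] at this

theorem exists_lt_of_mk_lt {s : Set Ordinal.{0}} {β : Ordinal.{0}}
    (hs : #s < Cardinal.lift.{1} β.cof) (hlt : ∀ i ∈ s, i < β) : ∃ b < β, ∀ i ∈ s, i < b := by
  refine ⟨sSup ((· + 1) '' s), Ordinal.sSup_add_one_lt_of_lt_cof ?_ hlt, fun i hi => ?_⟩
  · rwa [← Ordinal.lift_cof]
  · have hb : BddAbove ((· + 1) '' s) := by
      refine ⟨β, ?_⟩
      rintro _ ⟨j, hj, rfl⟩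
      exact Order.add_one_le_of_lt (hlt j hj)
    exact (Order.lt_add_one_iff.2 le_rfl).trans_le (le_csSup hb ⟨i, hi, rfl⟩)

theorem exists_lt_of_countable {s : Set Ordinal.{0}} {β : Ordinal.{0}} (hβ : β.cof = ℵ₁)
    (hs : s.Countable) (hlt : ∀ i ∈ s, i < β) : ∃ b < β, ∀ i ∈ s, i < b := by
  refine exists_lt_of_mk_lt ?_ hlt
  rw [hβ, Cardinal.lift_aleph]
  exact (Cardinal.mk_le_aleph0_iff.2 hs.to_subtype).trans_lt (by simp)

/-- A family of at most `ℵ₁` many ordinals below `ω₂` is bounded below `ω₂`. -/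
theorem exists_uniform_bound {T : Type 1} (hT : #T ≤ ℵ₁) (f : T → Ordinal.{0})
    (hf : ∀ t, f t < omegaTwo) : ∃ b < omegaTwo, ∀ t, f t < b := by
  obtain ⟨b, hb, h⟩ := exists_lt_of_mk_lt (s := Set.range f) (β := omegaTwo) (by
    rw [cof_omegaTwo, Cardinal.lift_aleph]
    refine (Cardinal.mk_range_le.trans hT).trans_lt ?_
    simp) (by rintro _ ⟨t, rfl⟩; exact hf t)
  exact ⟨b, hb, fun t => h _ ⟨t, rfl⟩⟩

theorem isSuccLimit_omegaTwo : Order.IsSuccLimit omegaTwo := Cardinal.isSuccLimit_omega 2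

theorem mk_Iio_le {β : Ordinal.{0}} (hβ : β < omegaTwo) : #(Set.Iio β) ≤ ℵ₁ := by
  rw [Cardinal.mk_Iio_ordinal]
  have h : β.card < ℵ_ 2 := by
    rw [← Cardinal.lt_ord, Cardinal.ord_aleph]
    exact hβ
  have h2 : (ℵ_ 2 : Cardinal.{0}) = Order.succ ℵ₁ := by
    rw [Cardinal.succ_aleph, one_add_one_eq_two]
  rw [h2, Order.lt_succ_iff] at h
  simpa using Cardinal.lift_le.{1}.2 h

/-- The closure points of a function on `ω₂` form a closed unbounded set. -/
theorem isClub_closurePoints {F : Ordinal.{0} → Ordinal.{0}}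
    (hF : ∀ ξ < omegaTwo, F ξ < omegaTwo) :
    IsClub {β | β < omegaTwo ∧ ∀ ξ < β, F ξ < β} := by
  refine ⟨fun β hβ => hβ.1, fun β hβ hlim => ⟨hβ, fun ξ hξ => ?_⟩, fun α hα => ?_⟩
  · obtain ⟨δ, hδ, hξδ, hδβ⟩ := hlim.2 ξ hξ
    exact (hδ.2 ξ hξδ).trans hδβ
  -- The supremum of `ω` iterates of `g` is closed under `F`, and stays below `ω₂` by regularity.
  · have hstep : ∀ γ < omegaTwo, ∃ b < omegaTwo, γ < b ∧ ∀ ξ < γ, F ξ < b := by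
      intro γ hγ
      obtain ⟨b, hb, h⟩ := exists_uniform_bound (mk_Iio_le hγ) (fun ξ => F ξ.1)
        (fun ξ => hF _ (lt_trans ξ.2 hγ))
      exact ⟨max b (Order.succ γ), max_lt hb (isSuccLimit_omegaTwo.succ_lt hγ),
        lt_max_of_lt_right (Order.lt_succ γ), fun ξ hξ => lt_max_of_lt_left (h ⟨ξ, hξ⟩)⟩
    choose! g hg hgγ hgF using hstep
    have hlt : ∀ n : ℕ, g^[n] α < omegaTwo := by
      intro n
      induction n with
      | zero => exact hα
      | succ n ih =>
        rw [Function.iterate_succ_apply']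
        exact hg _ ih
    have hbdd : BddAbove (Set.range fun n : ℕ => g^[n] α) :=
      ⟨omegaTwo, by rintro _ ⟨n, rfl⟩; exact (hlt n).le⟩
    have hle : ∀ n : ℕ, g^[n] α ≤ ⨆ n : ℕ, g^[n] α := fun n => le_ciSup hbdd n
    refine ⟨⨆ n : ℕ, g^[n] α, ⟨?_, fun ξ hξ => ?_⟩, hle 0⟩
    · refine Ordinal.iSup_lt_of_lt_cof ?_ hlt
      rw [cof_omegaTwo]
      simp
    · obtain ⟨n, hn⟩ := exists_lt_of_lt_ciSup hξ
      have h1 := hgF _ (hlt n) ξ hn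
      rw [← Function.iterate_succ_apply' g] at h1
      exact h1.trans_le (hle _)

theorem IsStationary.exists_closurePoint {Γ : Set Ordinal.{0}} (hΓ : IsStationary Γ)
    {F : Ordinal.{0} → Ordinal.{0}} (hF : ∀ ξ < omegaTwo, F ξ < omegaTwo) :
    ∃ β ∈ Γ, ∀ ξ < β, F ξ < β := by
  obtain ⟨β, hβ, -, h⟩ := hΓ.2 _ (isClub_closurePoints hF)
  exact ⟨β, hβ, h⟩

/-- Pressing down: if a regressive choice of a bound `δ` for `tr β` can be made at all
closure points `β ∈ Γ` of `F`, and at most `ℵ₁` values are admitted for each bound, then `tr` is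
constant on a pair of closure points. -/
theorem IsStationary.exists_pair {Γ : Set Ordinal.{0}} (hΓ : IsStationary Γ)
    {F : Ordinal.{0} → Ordinal.{0}} (hF : ∀ ξ < omegaTwo, F ξ < omegaTwo)
    {V : Type 1} (T : Ordinal.{0} → Set V) (hT : ∀ δ < omegaTwo, #(T δ) ≤ ℵ₁)
    (tr : Ordinal.{0} → V) (htr : ∀ β ∈ Γ, ∃ δ < β, tr β ∈ T δ) :
    ∃ β₁ ∈ Γ, ∃ β₂ ∈ Γ, β₁ < β₂ ∧ (∀ ξ < β₁, F ξ < β₁) ∧ (∀ ξ < β₂, F ξ < β₂) ∧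
      tr β₁ = tr β₂ := by
  let Γ' : Set Ordinal.{0} := {β | β ∈ Γ ∧ ∀ ξ < β, F ξ < β}
  -- `G δ` bounds simultaneously all those fibres of `tr` on `Γ'` over values in `T δ` that are
  -- bounded.
  have hG : ∀ δ < omegaTwo, ∃ b < omegaTwo, ∀ t ∈ T δ,
      (∃ c < omegaTwo, ∀ β ∈ Γ', tr β = t → β < c) → ∀ β ∈ Γ', tr β = t → β < b := by
    intro δ hδ
    have : ∀ t : T δ, ∃ c < omegaTwo, (∃ c < omegaTwo, ∀ β ∈ Γ', tr β = t.1 → β < c) →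
        ∀ β ∈ Γ', tr β = t.1 → β < c := by
      intro t
      by_cases h : ∃ c < omegaTwo, ∀ β ∈ Γ', tr β = t.1 → β < c
      · obtain ⟨c, hc, hc'⟩ := h
        exact ⟨c, hc, fun _ => hc'⟩
      · exact ⟨δ, hδ, fun h' => absurd h' h⟩
    choose c hc hc' using this
    obtain ⟨b, hb, hcb⟩ := exists_uniform_bound (hT δ hδ) c hc
    exact ⟨b, hb, fun t ht h β hβ htβ => (hc' ⟨t, ht⟩ h β hβ htβ).trans (hcb ⟨t, ht⟩)⟩
  choose! G hG hGb using hG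
  obtain ⟨β₁, hβ₁, hcl⟩ := hΓ.exists_closurePoint (F := fun ξ => max (F ξ) (G ξ))
    fun ξ hξ => max_lt (hF ξ hξ) (hG ξ hξ)
  have hF₁ : ∀ ξ < β₁, F ξ < β₁ := fun ξ hξ => (le_max_left _ _).trans_lt (hcl ξ hξ)
  obtain ⟨δ, hδ, hδT⟩ := htr β₁ hβ₁
  have hβ₁lt : β₁ < omegaTwo := hΓ.1 hβ₁
  -- Were the fibre of `β₁` bounded, `G δ` would lie above `β₁`, contrary to closure under `G`.
  have hunb : ¬ ∃ c < omegaTwo, ∀ β ∈ Γ', tr β = tr β₁ → β < c := by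
    intro h
    have h1 := hGb δ (hδ.trans hβ₁lt) _ hδT h β₁ ⟨hβ₁, hF₁⟩ rfl
    exact absurd ((le_max_right _ _).trans_lt (hcl δ hδ)) h1.not_gt
  push Not at hunb
  obtain ⟨β₂, ⟨hβ₂, hF₂⟩, hβ, hle⟩ := hunb _ (isSuccLimit_omegaTwo.succ_lt hβ₁lt)
  exact ⟨β₁, hβ₁, β₂, hβ₂, Order.succ_le_iff.1 hle, hF₁, hF₂, hβ.symm⟩

/-! ### Counting finite subsets and products -/

theorem mk_finset_le {α : Type 1} (h : #α ≤ ℵ₁) : #(Finset α) ≤ ℵ₁ := by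
  rcases finite_or_infinite α with hα | hα
  · exact (Cardinal.lt_aleph0_of_finite _).le.trans (Cardinal.aleph0_le_aleph 1)
  · rwa [Cardinal.mk_finset_of_infinite]

theorem mk_setOf_finset_subset_le {α : Type 1} {U : Set α} (h : #U ≤ ℵ₁) :
    #{s : Finset α | (s : Set α) ⊆ U} ≤ ℵ₁ := by
  classical
  refine le_trans ?_ (mk_finset_le h)
  refine (Cardinal.mk_le_mk_of_subset ?_).trans
    (Cardinal.mk_range_le (f := fun t : Finset U => t.image Subtype.val))
  intro s hs
  obtain ⟨t, ht⟩ := Finset.subset_set_image_iff (s := Set.univ) (f := (Subtype.val : U → α)) |>.1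
    (show (s : Set α) ⊆ Subtype.val '' Set.univ by simpa using hs)
  exact ⟨t, ht.2⟩

theorem mk_prod_le {α β : Type 1} {s : Set α} {t : Set β} (hs : #s ≤ ℵ₁) (ht : #t ≤ ℵ₁) :
    #(s ×ˢ t : Set (α × β)) ≤ ℵ₁ := by
  rw [Cardinal.mk_setProd]
  exact (mul_le_mul' hs ht).trans (Cardinal.mul_eq_self (Cardinal.aleph0_le_aleph 1)).le

variable {Γ : Set Ordinal.{0}}

/-! ### Comparison points -/

/-- By minimality of `τ` in `Γ` above `sup (M ∩ τ)`. This is how comparison points get bounded. -/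
theorem le_of_mem_gammaOf {M : Set Ordinal.{0}} {τ β : Ordinal.{0}} (hτ : τ ∈ gammaOf Γ M)
    (hβ : β ∈ Γ) (h : ∀ i ∈ M, i < τ → i ≤ β) : τ ≤ β :=
  hτ.2.2 ⟨hβ, csSup_le' fun i hi => h i hi.1 hi.2⟩

theorem mem_gammaOf_congr {M N : Set Ordinal.{0}} {τ : Ordinal.{0}}
    (h : M ∩ Set.Iio τ = N ∩ Set.Iio τ) (hτ : τ ∈ gammaOf Γ M) : τ ∈ gammaOf Γ N := by
  unfold gammaOf at *
  rwa [Set.mem_ofPred_eq, h] at hτ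

theorem comparisonPoint_comm (Γ M N : Set Ordinal.{0}) :
    comparisonPoint Γ M N = comparisonPoint Γ N M := by
  rw [comparisonPoint, comparisonPoint, Set.inter_comm]

theorem inter_Iio_eq_of_le {M N : Set Ordinal.{0}} {β ζ : Ordinal.{0}}
    (h : M ∩ Set.Iio β = N ∩ Set.Iio β) (hζ : ζ ≤ β) : M ∩ Set.Iio ζ = N ∩ Set.Iio ζ := by
  have h' : Set.Iio ζ = Set.Iio β ∩ Set.Iio ζ :=
    (Set.inter_eq_right.2 (Set.Iio_subset_Iio hζ)).symm
  rw [h', ← Set.inter_assoc, ← Set.inter_assoc, h]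

/-- One of `M ∩ β = N ∩ β`, `M ∩ β ∈ Sk(N)`, `N ∩ β ∈ Sk(M)` holds, where `β = β_{M,N}`. -/
def Comparable (π : Enumeration) (Y : Set (Set Ordinal.{0})) (Γ M N : Set Ordinal.{0}) : Prop :=
  M ∩ Set.Iio (comparisonPoint Γ M N) = N ∩ Set.Iio (comparisonPoint Γ M N) ∨
    MemSk π Y (M ∩ Set.Iio (comparisonPoint Γ M N)) N ∨
    MemSk π Y (N ∩ Set.Iio (comparisonPoint Γ M N)) M

theorem Comparable.symm {M N : Set Ordinal.{0}} (h : Comparable π Y Γ M N) :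
    Comparable π Y Γ N M := by
  unfold Comparable at *
  rw [comparisonPoint_comm Γ N M]
  exact h.imp Eq.symm Or.symm

/-- Comparability of `M` with `N` follows from comparability with a model `N'` such that
`N ∩ β₂ = N' ∩ β₁`, when `M` is bounded below `β₂`. -/
theorem Comparable.of_inter_Iio_eq (hYc : Y ⊆ countableSubsets) (hΓ : Γ ⊆ setLambda π Y)
    {β₁ β₂ : Ordinal.{0}} (h12 : β₁ < β₂) (hβ₁ : β₁ ∈ Γ) (hβ₂ : β₂ ∈ Γ)
    (hidx : ∀ a ∈ Y, ∀ ξ < β₁, ∀ x, IsSetOfOrds x (a ∩ Set.Iio ξ) → (π.symm x).1 < β₁)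
    {M N N' : Set Ordinal.{0}} (hM : M ∈ models π Y) (hN : N ∈ models π Y)
    (hN' : N' ∈ models π Y) (hMβ : ∀ i ∈ M, i < β₂)
    (hNN' : N' ∩ Set.Iio β₁ = N ∩ Set.Iio β₂)
    (h : Comparable π Y Γ M N') : Comparable π Y Γ M N := by
  have hNN'₁ : N ∩ Set.Iio β₁ = N' ∩ Set.Iio β₁ := by
    have := congrArg (· ∩ Set.Iio β₁) hNN'
    simp only [Set.inter_assoc, Set.Iio_inter_Iio, inf_idem, inf_eq_right.2 h12.le] at this
    exact this.symm
  -- Minimality is used twice: `β₂` bounds `M`, so `τ ≤ β₂`; then `N ∩ τ ⊆ N' ∩ β₁` is bounded by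
  -- `β₁`.
  have hle : ∀ τ ∈ gammaOf Γ M ∩ gammaOf Γ N, τ ≤ β₁ := by
    rintro τ ⟨hτM, hτN⟩
    have hτ₂ : τ ≤ β₂ := le_of_mem_gammaOf hτM hβ₂ fun i hi _ => (hMβ i hi).le
    refine le_of_mem_gammaOf hτN hβ₁ fun i hi hiτ => ?_
    have : i ∈ N' ∩ Set.Iio β₁ := by
      rw [hNN']
      exact ⟨hi, hiτ.trans_le hτ₂⟩
    exact le_of_lt this.2
  have hζ : comparisonPoint Γ M N ≤ β₁ := csSup_le' hle
  have hbdd : BddAbove (gammaOf Γ M ∩ gammaOf Γ N') :=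
    ⟨omegaTwo, fun τ hτ => (hΓ hτ.1.1).1.le⟩
  have hζθ : comparisonPoint Γ M N ≤ comparisonPoint Γ M N' := by
    refine csSup_le' fun τ hτ => le_csSup hbdd ⟨hτ.1, ?_⟩
    exact mem_gammaOf_congr (inter_Iio_eq_of_le hNN'₁ (hle τ hτ)) hτ.2
  have hNζ := inter_Iio_eq_of_le hNN'₁ hζ
  have hIio : ∀ K : Set Ordinal.{0}, K ∩ Set.Iio (comparisonPoint Γ M N') ∩
      Set.Iio (comparisonPoint Γ M N) = K ∩ Set.Iio (comparisonPoint Γ M N) := by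
    intro K
    rw [Set.inter_assoc, Set.inter_eq_right.2 (Set.Iio_subset_Iio hζθ)]
  have hcount : ∀ K ∈ models π Y, (K ∩ Set.Iio (comparisonPoint Γ M N')).Countable :=
    fun K hK => (hYc hK.1).1.mono Set.inter_subset_left
  rcases h with h | h | h
  · left
    rw [hNζ]
    exact inter_Iio_eq_of_le h hζθ
  · right; left
    have h' := h.inter_Iio (hcount M hM) (comparisonPoint Γ M N)
    rw [hIio] at h'
    refine MemSk.of_inter_Iio_eq hN.2.1 hN'.2.1 hNN'₁ ?_ h'
    -- The comparison point may equal `β₁`, while `hidx` needs a cut strictly below it. As `M ∩ β₁`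
    -- is bounded in `β₁`, the cut can be lowered.
    obtain ⟨δ, hδ, hMδ⟩ := exists_lt_of_countable (hΓ hβ₁).2.1
      ((hYc hM.1).1.mono Set.inter_subset_left : (M ∩ Set.Iio β₁).Countable) fun i hi => hi.2
    have hδeq : M ∩ Set.Iio (comparisonPoint Γ M N) =
        M ∩ Set.Iio (min δ (comparisonPoint Γ M N)) := by
      ext i
      refine and_congr_right fun hi => ⟨fun h => ?_, fun h => ?_⟩
      · exact lt_min (hMδ i ⟨hi, lt_of_lt_of_le h hζ⟩) h
      · exact lt_of_lt_of_le (Set.mem_Iio.1 h) (min_le_right _ _)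
    rw [hδeq]
    exact hidx M hM.1 _ ((min_le_left _ _).trans_lt hδ)
  · right; right
    have h' := h.inter_Iio (hcount N' hN') (comparisonPoint Γ M N)
    rwa [hIio, ← hNζ] at h'

/-! ### Traces of conditions -/

/-- The ordinals that occur in the first component of a condition, as first components of triples,
or in models. -/
def support (p : Condition π Y Γ) : Set Ordinal.{0} :=
  (p.a : Set Ordinal.{0}) ∪ Prod.fst '' (p.x : Set (Ordinal.{0} × Ordinal.{0} × Ordinal.{0})) ∪
    ⋃ M ∈ p.A, M

theorem countable_support (hYc : Y ⊆ countableSubsets) (p : Condition π Y Γ) :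
    (support p).Countable := by
  refine (p.a.countable_toSet.union (p.x.countable_toSet.image _)).union ?_
  exact p.A.countable_toSet.biUnion fun M hM => (hYc (p.adequate.1 hM).1).1

theorem support_lt (hYc : Y ⊆ countableSubsets) (hΓ : Γ ⊆ setLambda π Y) (p : Condition π Y Γ) :
    ∀ i ∈ support p, i < omegaTwo := by
  rintro i ((hi | ⟨⟨α, γ, β⟩, ht, rfl⟩) | hi)
  · exact (p.a_cof i hi).1
  · exact (hΓ (p.x_lt α γ β ht).1).1
  · simp only [Set.mem_iUnion] at hi
    obtain ⟨M, hM, hi⟩ := hi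
    exact (hYc (p.adequate.1 hM).1).2 hi

theorem mem_support_of_mem_a {p : Condition π Y Γ} {ξ : Ordinal.{0}} (h : ξ ∈ p.a) :
    ξ ∈ support p := Or.inl (Or.inl h)

theorem mem_support_of_mem_x {p : Condition π Y Γ} {t : Ordinal.{0} × Ordinal.{0} × Ordinal.{0}}
    (h : t ∈ p.x) : t.1 ∈ support p := Or.inl (Or.inr ⟨t, h, rfl⟩)

theorem mem_support_of_mem {p : Condition π Y Γ} {M : Set Ordinal.{0}} (hM : M ∈ p.A)
    {i : Ordinal.{0}} (hi : i ∈ M) : i ∈ support p :=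
  Or.inr (Set.mem_biUnion hM hi)

open Classical in
/-- The trace of a condition below `β`. -/
noncomputable def trace (p : Condition π Y Γ) (β : Ordinal.{0}) :
    Finset Ordinal.{0} × Finset (Ordinal.{0} × Ordinal.{0} × Ordinal.{0}) ×
      Finset (Set Ordinal.{0}) :=
  (p.a.filter (· < β), p.x.filter (·.1 < β), p.A.image (· ∩ Set.Iio β))

theorem mem_trace_fst {p : Condition π Y Γ} {β ξ : Ordinal.{0}} :
    ξ ∈ (trace p β).1 ↔ ξ ∈ p.a ∧ ξ < β := by
  simp [trace]

theorem mem_trace_snd_fst {p : Condition π Y Γ} {β : Ordinal.{0}}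
    {t : Ordinal.{0} × Ordinal.{0} × Ordinal.{0}} :
    t ∈ (trace p β).2.1 ↔ t ∈ p.x ∧ t.1 < β := by
  simp [trace]

theorem mem_trace_snd_snd {p : Condition π Y Γ} {β : Ordinal.{0}} {K : Set Ordinal.{0}} :
    K ∈ (trace p β).2.2 ↔ ∃ M ∈ p.A, M ∩ Set.Iio β = K := by
  simp [trace]

/-- A set of `ℵ₁` many triples that contains all traces bounded by `δ`. -/
def traces (Y : Set (Set Ordinal.{0})) (δ : Ordinal.{0}) :
    Set (Finset Ordinal.{0} × Finset (Ordinal.{0} × Ordinal.{0} × Ordinal.{0}) ×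
      Finset (Set Ordinal.{0})) :=
  {s : Finset Ordinal.{0} | (s : Set Ordinal.{0}) ⊆ Set.Iio δ} ×ˢ
    {s : Finset (Ordinal.{0} × Ordinal.{0} × Ordinal.{0}) | (s : Set _) ⊆
      Set.Iio δ ×ˢ Set.Iio δ ×ˢ Set.Iio δ} ×ˢ
    {s : Finset (Set Ordinal.{0}) | (s : Set (Set Ordinal.{0})) ⊆
      (fun a : Set Ordinal.{0} => a ∩ Set.Iio δ) '' Y}

theorem mk_traces_le (hY : IsThin Y) {δ : Ordinal.{0}} (hδ : δ < omegaTwo) :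
    #(traces Y δ) ≤ ℵ₁ := by
  have h := mk_Iio_le hδ
  exact mk_prod_le (mk_setOf_finset_subset_le h) (mk_prod_le
    (mk_setOf_finset_subset_le (mk_prod_le h (mk_prod_le h h)))
    (mk_setOf_finset_subset_le (hY δ hδ)))

/-- The support is countable, so its part below `β` is bounded in `β`; cutting the models at that
bound or at `β` gives the same sets. -/
theorem exists_trace_mem (hYc : Y ⊆ countableSubsets) (p : Condition π Y Γ) {β : Ordinal.{0}}
    (hβ : β.cof = ℵ₁) : ∃ δ < β, trace p β ∈ traces Y δ := by
  obtain ⟨δ, hδ, h⟩ := exists_lt_of_countable hβ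
    ((countable_support hYc p).mono Set.inter_subset_left : (support p ∩ Set.Iio β).Countable)
    fun i hi => hi.2
  refine ⟨δ, hδ, ?_, ?_, ?_⟩
  · intro ξ hξ
    obtain ⟨hξa, hξβ⟩ := mem_trace_fst.1 hξ
    exact h ξ ⟨mem_support_of_mem_a hξa, hξβ⟩
  · rintro ⟨α, γ, ε⟩ ht
    obtain ⟨htx, htβ⟩ := mem_trace_snd_fst.1 ht
    have hα : α < δ := h α ⟨mem_support_of_mem_x htx, htβ⟩
    obtain ⟨-, hγε, hεα⟩ := p.x_lt α γ ε htx
    exact ⟨hα, (hγε.trans hεα).trans hα, hεα.trans hα⟩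
  · intro K hK
    obtain ⟨M, hM, rfl⟩ := mem_trace_snd_snd.1 hK
    refine ⟨M, (p.adequate.1 hM).1, ?_⟩
    ext i
    refine and_congr_right fun hi => ⟨fun hiδ => lt_trans hiδ hδ, fun hiβ => ?_⟩
    exact h i ⟨mem_support_of_mem hM hi, hiβ⟩

/-! ### Amalgamation -/

/-- The componentwise union works. Points and triples of `p₂` below `β₂` already belong to `p₁`.
Those of `p₁` missing from `p₂` sit in `[β₁, β₂)` (triples by first component), an interval that the
models of `p₂` avoid. -/
theorem compatible_of_trace_eq (hYc : Y ⊆ countableSubsets) (hΓ : Γ ⊆ setLambda π Y)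
    {β₁ β₂ : Ordinal.{0}} (h12 : β₁ < β₂) (hβ₁ : β₁ ∈ Γ) (hβ₂ : β₂ ∈ Γ)
    (hidx : ∀ a ∈ Y, ∀ ξ < β₁, ∀ x, IsSetOfOrds x (a ∩ Set.Iio ξ) → (π.symm x).1 < β₁)
    {p₁ p₂ : Condition π Y Γ} {b : Ordinal.{0}} (hb : b < β₂) (hp₁ : ∀ i ∈ support p₁, i < b)
    (htr : trace p₁ β₁ = trace p₂ β₂) : Compatible p₁ p₂ := by
  classical
  have hp₁' : ∀ i ∈ support p₁, i < β₂ := fun i hi => (hp₁ i hi).trans hb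
  have ha₂ : ∀ ξ ∈ p₂.a, ξ < β₂ → ξ ∈ p₁.a := fun ξ hξ h =>
    (mem_trace_fst.1 (htr ▸ mem_trace_fst.2 ⟨hξ, h⟩)).1
  have ha₁ : ∀ ξ ∈ p₁.a, ξ ∉ p₂.a → β₁ ≤ ξ := fun ξ hξ h =>
    not_lt.1 fun h' => h (mem_trace_fst.1 (htr ▸ mem_trace_fst.2 ⟨hξ, h'⟩)).1
  have hx₂ : ∀ t ∈ p₂.x, t.1 < β₂ → t ∈ p₁.x := fun t ht h =>
    (mem_trace_snd_fst.1 (htr ▸ mem_trace_snd_fst.2 ⟨ht, h⟩)).1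
  have hx₁ : ∀ t ∈ p₁.x, t ∉ p₂.x → β₁ ≤ t.1 := fun t ht h =>
    not_lt.1 fun h' => h (mem_trace_snd_fst.1 (htr ▸ mem_trace_snd_fst.2 ⟨ht, h'⟩)).1
  have hA : ∀ N ∈ p₂.A, ∃ N' ∈ p₁.A, N' ∩ Set.Iio β₁ = N ∩ Set.Iio β₂ := fun N hN =>
    mem_trace_snd_snd.1 (htr ▸ mem_trace_snd_snd.2 ⟨N, hN, rfl⟩)
  -- `N ∩ β₂` is a countable subset of `β₁`, hence bounded there: `N` has a gap `[δ, β₂)`.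
  have hN₂ : ∀ N ∈ p₂.A, ∃ δ < β₁, ∀ i ∈ N, i < β₂ → i < δ := by
    intro N hN
    obtain ⟨δ, hδ, h⟩ := exists_lt_of_countable (s := N ∩ Set.Iio β₂) (hΓ hβ₁).2.1
      ((hYc (p₂.adequate.1 hN).1).1.mono Set.inter_subset_left) (by
        obtain ⟨N', -, h⟩ := hA N hN
        rw [← h]
        exact fun i hi => hi.2)
    exact ⟨δ, hδ, fun i hi hi' => h i ⟨hi, hi'⟩⟩
  have hcross : ∀ M ∈ p₁.A, ∀ N ∈ p₂.A, Comparable π Y Γ M N := by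
    intro M hM N hN
    obtain ⟨N', hN', h⟩ := hA N hN
    exact Comparable.of_inter_Iio_eq hYc hΓ h12 hβ₁ hβ₂ hidx (p₁.adequate.1 hM)
      (p₂.adequate.1 hN) (p₁.adequate.1 hN') (fun i hi => hp₁' i (mem_support_of_mem hM hi)) h
      (p₁.adequate.2 M hM N' hN')
  have hMx : ∀ M ∈ p₁.A, ∀ α ∈ M, ∀ γ β, (α, γ, β) ∈ p₂.x → (α, γ, β) ∈ p₁.x :=
    fun M hM α hα γ β ht => hx₂ _ ht (hp₁' α (mem_support_of_mem hM hα))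
  have hNx : ∀ N ∈ p₂.A, ∀ α ∈ N, ∀ γ β, (α, γ, β) ∈ p₁.x → (α, γ, β) ∈ p₂.x := by
    intro N hN α hα γ β ht
    by_contra hc
    obtain ⟨δ, hδ, h⟩ := hN₂ N hN
    exact absurd ((h α hα (hp₁' α (mem_support_of_mem_x ht))).trans hδ) (hx₁ _ ht hc).not_gt
  refine ⟨
    { a := p₁.a ∪ p₂.a
      x := p₁.x ∪ p₂.x
      A := p₁.A ∪ p₂.A
      a_cof := fun ξ hξ => (Finset.mem_union.1 hξ).elim (p₁.a_cof ξ) (p₂.a_cof ξ)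
      x_lt := fun α γ β h => (Finset.mem_union.1 h).elim (p₁.x_lt α γ β) (p₂.x_lt α γ β)
      adequate := ?_
      x_disjoint := ?_
      a_closed := ?_
      x_closed := ?_ },
    ⟨Finset.subset_union_left, Finset.subset_union_left, Finset.subset_union_left⟩,
    ⟨Finset.subset_union_right, Finset.subset_union_right, Finset.subset_union_right⟩⟩
  · refine ⟨fun M hM => ?_, fun M hM N hN => ?_⟩
    · exact (Finset.mem_union.1 hM).elim (fun h => p₁.adequate.1 h) (fun h => p₂.adequate.1 h)
    · rcases Finset.mem_union.1 hM with hM | hM <;> rcases Finset.mem_union.1 hN with hN | hN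
      · exact p₁.adequate.2 M hM N hN
      · exact hcross M hM N hN
      · exact (hcross N hN M hM).symm
      · exact p₂.adequate.2 M hM N hN
  · have hd : ∀ α γ β γ' β', (α, γ, β) ∈ p₁.x → (α, γ', β') ∈ p₂.x → (α, γ', β') ∈ p₁.x :=
      fun α γ β γ' β' h h' => hx₂ _ h' (hp₁' α (mem_support_of_mem_x h))
    intro α γ β γ' β' h h' hne
    rcases Finset.mem_union.1 h with h | h <;> rcases Finset.mem_union.1 h' with h' | h'
    · exact p₁.x_disjoint _ _ _ _ _ h h' hne
    · exact p₁.x_disjoint _ _ _ _ _ h (hd _ _ _ _ _ h h') hne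
    · exact p₁.x_disjoint _ _ _ _ _ (hd _ _ _ _ _ h' h) h' hne
    · exact p₂.x_disjoint _ _ _ _ _ h h' hne
  · intro ξ hξ M hM hsup hne
    rcases Finset.mem_union.1 hM with hM | hM
    · by_cases hξ₁ : ξ ∈ p₁.a
      · exact p₁.a_closed ξ hξ₁ M hM hsup hne
      · have hξ₂ := (Finset.mem_union.1 hξ).resolve_left hξ₁
        -- The bound `b < β₂` makes `ξ < β₂` strict, so `ξ` falls into the common trace.
        have : sSup (M ∩ Set.Iio ξ) ≤ b :=
          csSup_le' fun i hi => (hp₁ i (mem_support_of_mem hM hi.1)).le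
        rw [hsup] at this
        exact absurd (ha₂ ξ hξ₂ (this.trans_lt hb)) hξ₁
    · by_cases hξ₂ : ξ ∈ p₂.a
      · exact p₂.a_closed ξ hξ₂ M hM hsup hne
      · have hξ₁ := (Finset.mem_union.1 hξ).resolve_right hξ₂
        obtain ⟨δ, hδ, h⟩ := hN₂ M hM
        -- A limit point of `M` below `β₂` is at most `δ < β₁`, yet a new point of `p₁` is at least
        -- `β₁`.
        have : sSup (M ∩ Set.Iio ξ) ≤ δ := csSup_le' fun i hi =>
          (h i hi.1 (lt_trans hi.2 (hp₁' ξ (mem_support_of_mem_a hξ₁)))).le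
        rw [hsup] at this
        exact absurd (this.trans_lt hδ) (ha₁ ξ hξ₁ hξ₂).not_gt
  · intro M hM α hα γ β ht
    rcases Finset.mem_union.1 hM with hM | hM
    · exact p₁.x_closed M hM α hα γ β
        ((Finset.mem_union.1 ht).elim id (hMx M hM α hα γ β))
    · exact p₂.x_closed M hM α hα γ β
        ((Finset.mem_union.1 ht).elim (hNx M hM α hα γ β) id)

/-- Thinness leaves at most `ω₁` sets `a ∩ ξ`, so their indices are bounded in `ω₂`. -/
theorem exists_index_bound (π : Enumeration) (hYc : Y ⊆ countableSubsets) (hY : IsThin Y)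
    {ξ : Ordinal.{0}} (hξ : ξ < omegaTwo) : ∃ b < omegaTwo, ∀ a ∈ Y, ∀ x,
      IsSetOfOrds x (a ∩ Set.Iio ξ) → (π.symm x).1 < b := by
  have hex : ∀ t : ((fun a : Set Ordinal.{0} => a ∩ Set.Iio ξ) '' Y), ∃ x,
      IsSetOfOrds x t.1 := by
    rintro ⟨_, a, ha, rfl⟩
    exact exists_isSetOfOrds ⟨(hYc ha).1.mono Set.inter_subset_left,
      Set.inter_subset_left.trans (hYc ha).2⟩
  choose g hg using hex
  obtain ⟨b, hb, h⟩ := exists_uniform_bound (hY ξ hξ) (fun t => (π.symm (g t)).1)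
    (fun t => (π.symm (g t)).2)
  refine ⟨b, hb, fun a ha x hx => ?_⟩
  have h1 := h ⟨_, a, ha, rfl⟩
  rwa [(hg ⟨_, a, ha, rfl⟩).unique hx] at h1

theorem exists_support_bound (hYc : Y ⊆ countableSubsets) (hΓ : Γ ⊆ setLambda π Y)
    (p : Condition π Y Γ) : ∃ b < omegaTwo, ∀ i ∈ support p, i < b := by
  obtain ⟨b, hb, h⟩ := exists_uniform_bound (T := support p)
    ((Cardinal.mk_le_aleph0_iff.2 (countable_support hYc p).to_subtype).trans
      (Cardinal.aleph0_le_aleph 1)) Subtype.val (fun i => support_lt hYc hΓ p i i.2)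
  exact ⟨b, hb, fun i hi => h ⟨i, hi⟩⟩

theorem exists_embedding {P : Type 1} {S : Set P} (hS : ℵ_ 2 ≤ #S) :
    ∃ p : Ordinal.{0} → P, (∀ β, p β ∈ S) ∧ Set.InjOn p (Set.Iio omegaTwo) := by
  have hcard : #(Set.Iio omegaTwo) ≤ #S := by
    rw [Cardinal.mk_Iio_ordinal, Ordinal.card_omega]
    simpa using hS
  obtain ⟨e⟩ := hcard
  classical
  -- Beyond `ω₂` any element of `S` serves as the default value.
  refine ⟨fun β => if h : β < omegaTwo then (e ⟨β, h⟩).1 else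
    (e ⟨ω, omega0_lt_omegaTwo⟩).1, fun β => ?_, fun β hβ γ hγ h => ?_⟩
  · dsimp only
    split_ifs
    · exact (e _).2
    · exact (e _).2
  · dsimp only at h
    rw [dif_pos (Set.mem_Iio.1 hβ), dif_pos (Set.mem_Iio.1 hγ)] at h
    exact congrArg Subtype.val (e.injective (Subtype.ext h))

end AdequateForcing

theorem proposition6p3
    (h_pow : (2 : Cardinal.{0}) ^ (ℵ_ 1 : Cardinal.{0}) = ℵ_ 2)
    (π : AdequateForcing.Enumeration)
    (Y : Set (Set Ordinal.{0}))
    (hY_stat : AdequateForcing.IsStationaryCountable Y)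
    (hY_thin : AdequateForcing.IsThin Y)
    (hY_closed : AdequateForcing.ClosedUnderInitialSegments Y)
    (Γ : Set Ordinal.{0})
    (hΓ_sub : Γ ⊆ AdequateForcing.setLambda π Y)
    (hΓ_stat : AdequateForcing.IsStationary Γ) :
    AdequateForcing.OmegaTwoCC (AdequateForcing.Condition π Y Γ) := by
  open AdequateForcing in
  intro S hS
  by_contra hc
  obtain ⟨p, hpS, hpinj⟩ := exists_embedding (not_lt.1 hc)
  have hYc := hY_stat.1
  have hF : ∀ ξ < omegaTwo, ∃ b < omegaTwo,
      (∀ a ∈ Y, ∀ x, IsSetOfOrds x (a ∩ Set.Iio ξ) → (π.symm x).1 < b) ∧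
      ∀ i ∈ support (p ξ), i < b := by
    intro ξ hξ
    obtain ⟨b, hb, h⟩ := exists_index_bound π hYc hY_thin hξ
    obtain ⟨c, hc, h'⟩ := exists_support_bound hYc hΓ_sub (p ξ)
    exact ⟨max b c, max_lt hb hc, fun a ha x hx => lt_max_of_lt_left (h a ha x hx),
      fun i hi => lt_max_of_lt_right (h' i hi)⟩
  choose! F hF hFidx hFsupp using hF
  obtain ⟨β₁, hβ₁, β₂, hβ₂, h12, hF₁, hF₂, htr⟩ := hΓ_stat.exists_pair hF (traces Y)
    (fun δ hδ => mk_traces_le hY_thin hδ) (fun β => trace (p β) β)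
    (fun β hβ => exists_trace_mem hYc (p β) (hΓ_sub hβ).2.1)
  have hlt₁ := hΓ_stat.1 hβ₁
  refine hS _ (hpS β₁) _ (hpS β₂) (fun h => h12.ne (hpinj hlt₁ (hΓ_stat.1 hβ₂) h)) ?_
  -- The bound for the support of `p β₁` is `F β₁`, which is below `β₂` because `β₂` is closed under
  -- `F`.
  exact compatible_of_trace_eq hYc hΓ_sub h12 hβ₁ hβ₂
    (fun a ha ξ hξ x hx => (hFidx ξ (hξ.trans hlt₁) a ha x hx).trans (hF₁ ξ hξ))
    (hF₂ β₁ h12) (hFsupp β₁ hlt₁) htr
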